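/- **Log-convexity of $P_t$.** Let $H$ be a real separable Hilbert space with norm $|\cdot|$, and let $m$ be a centered nondegenerate Gaussian measure on $H$ with covariance operator $Q$ (a nonnegative symmetric trace-class operator; nondegenerate means that $Q$ is injective). Put $A:=-\tfrac12 Q^{-1}$, let $e^{tA}$ ($t\ge 0$) be the semigroup it generates, which acts as $e^{-t/(2\mu)}$ on the eigenspace $\ker(Q-\mu)$ of each eigenvalue $\mu$ of $Q$, and let $Q_t:=\int_0^t e^{2sA}\,ds=Q(1-e^{2tA})$. Let $N_{Q_t}$ be the centered Gaussian measure on $H$ with covariance operator $Q_t$. For Borel $f:H\to[0,\infty)$ and $t>0$ define $$P_tf(x):=\int_H f(e^{tA}x+y)\,dN_{Q_t}(y)\in[0,\infty],\qquad x\in H.$$ Then for every nonnegative Borel function $g:H\to\mathbb R$ and every $t>0$ the map $\log P_tg:H\to[-\infty,\infty]$ is $(-\tfrac1t)$-convex on $H$, i.e. for all $x_0,x_1\in H$ and $s\in[0,1]$ $$\log P_tg((1-s)x_0+sx_1)\le(1-s)\log P_tg(x_0)+s\log P_tg(x_1)+\frac{s(1-s)}{2t}|x_1-x_0|^2 ;$$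 explicitly, $$P_tg((1-s)x_0+sx_1)\le\exp\Big\{\frac{s(1-s)|x_1-x_0|^2}{2t}\Big\}\,(P_tg(x_0))^{1-s}\,(P_tg(x_1))^{s}$$ for all $x_0,x_1\in H$ and $s\in[0,1]$, with the conventions $0\cdot(\pm\infty)=0$ and $0^0=\infty^0=1$. -/

import Mathlib

open MeasureTheory ProbabilityTheory Module.End
open scoped ENNReal RealInnerProductSpace

namespace OUSemigroup

section definitions

variable {H : Type*} [NormedAddCommGroup H] [InnerProductSpace ℝ H] [CompleteSpace H]

instance (Q : H →L[ℝ] H) (μ : ℝ) :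
    (eigenspace (Q : H →ₗ[ℝ] H) μ).HasOrthogonalProjection :=
  haveI : CompleteSpace (eigenspace (Q : H →ₗ[ℝ] H) μ) :=
    (ContinuousLinearMap.isClosed_eigenspace Q μ).completeSpace_coe
  inferInstance

/-- The functional calculus `φ(Q) x = ∑_μ φ(μ) P_μ x` of a compact self-adjoint operator `Q`; the
sum runs over the eigenvalues `μ` of `Q`, and `P_μ` is the orthogonal projection onto the
eigenspace `ker (Q - μ)`. -/
noncomputable def spectralSum (Q : H →L[ℝ] H) (φ : ℝ → ℝ) (x : H) : H :=
  ∑' μ : Eigenvalues (Q : H →ₗ[ℝ] H),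
    φ (μ : ℝ) • (eigenspace (Q : H →ₗ[ℝ] H) (μ : ℝ)).starProjection x

/-- The operator `e^{tA}`, where `A = -(1/2) Q⁻¹` (an unbounded self-adjoint operator) and `Q` is
an injective nonnegative compact self-adjoint operator: it acts as `e^{-t/(2μ)}` on the eigenspace
`ker (Q - μ)`. -/
noncomputable def expA (Q : H →L[ℝ] H) (t : ℝ) (x : H) : H :=
  spectralSum Q (fun μ => Real.exp (-t / (2 * μ))) x

/-- The operator `Q_t = ∫₀ᵗ e^{2sA} ds`. -/
noncomputable def covT (Q : H →L[ℝ] H) (t : ℝ) (x : H) : H :=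
  ∫ s in (0 : ℝ)..t, expA Q (2 * s) x

/-- `φ : H → [-∞, ∞]` is `K`-convex: for all `x₀, x₁` and `s ∈ [0, 1]`,
`φ((1-s)x₀ + s x₁) ≤ (1-s) φ(x₀) + s φ(x₁) - (K/2) s(1-s) |x₁ - x₀|²`. -/
def IsKConvex (K : ℝ) (φ : H → EReal) : Prop :=
  ∀ x₀ x₁ : H, ∀ s ∈ Set.Icc (0 : ℝ) 1,
    φ ((1 - s) • x₀ + s • x₁) ≤
      ((1 - s : ℝ) : EReal) * φ x₀ + (s : EReal) * φ x₁
        - ((K / 2 * (s * (1 - s)) * ‖x₁ - x₀‖ ^ 2 : ℝ) : EReal)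

variable [MeasurableSpace H] [BorelSpace H]

/-- `μ` is a Gaussian measure on `H` with mean `a` and covariance operator `R`. -/
structure IsGaussianWith (a : H) (R : H → H) (μ : Measure H) : Prop where
  gaussian : IsGaussian μ
  mean : ∫ x, x ∂μ = a
  cov : ∀ x y, covarianceBilin μ x y = ⟪R x, y⟫

open scoped Classical in
/-- The Gaussian measure `N_{a,R}` with mean `a` and covariance operator `R`. -/
noncomputable def gaussianMeasure (a : H) (R : H → H) : Measure H :=
  if h : ∃ μ : Measure H, IsGaussianWith a R μ then h.choose else 0

/-- The semigroup `P_t f(x) = ∫ f(e^{tA} x + y) dN_{0,Q_t}(y)` (Mehler's formula) attached to the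
centered Gaussian measure `m`, on nonnegative functions; the values are in `[0, ∞]`. -/
noncomputable def semigroupP (m : Measure H) (t : ℝ) (f : H → ℝ≥0∞) (x : H) : ℝ≥0∞ :=
  ∫⁻ y, f (expA (covarianceOperator m) t x + y)
    ∂(gaussianMeasure (0 : H) (covT (covarianceOperator m) t))

end definitions

section spectral

variable {H : Type*} [NormedAddCommGroup H] [InnerProductSpace ℝ H] [CompleteSpace H]
variable {Q : H →L[ℝ] H}

lemma sum_norm_sq_proj_le (hQ : (Q : H →ₗ[ℝ] H).IsSymmetric) (x : H)
    (s : Finset (Eigenvalues (Q : H →ₗ[ℝ] H))) :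
    ∑ μ ∈ s, ‖(eigenspace (Q : H →ₗ[ℝ] H) (μ : ℝ)).starProjection x‖ ^ 2 ≤ ‖x‖ ^ 2 := by
  have hV := hQ.orthogonalFamily_eigenspaces'
  have h1 := hV.norm_sum
    (fun μ => (eigenspace (Q : H →ₗ[ℝ] H) (μ : ℝ)).orthogonalProjectionOnto x) s
  have h1 : ‖∑ μ ∈ s, (eigenspace (Q : H →ₗ[ℝ] H) (μ : ℝ)).starProjection x‖ ^ 2 =
      ∑ μ ∈ s, ‖(eigenspace (Q : H →ₗ[ℝ] H) (μ : ℝ)).starProjection x‖ ^ 2 := h1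
  have h2 : ∑ μ ∈ s, ‖(eigenspace (Q : H →ₗ[ℝ] H) (μ : ℝ)).starProjection x‖ ^ 2
      = ⟪∑ μ ∈ s, (eigenspace (Q : H →ₗ[ℝ] H) (μ : ℝ)).starProjection x, x⟫ := by
    rw [sum_inner]
    refine Finset.sum_congr rfl fun μ _ => ?_
    rw [← real_inner_self_eq_norm_sq]
    conv_lhs => rw [← Submodule.inner_starProjection_left_eq_right]
    rw [Submodule.starProjection_eq_self_iff.2 (Submodule.starProjection_apply_mem _ _)]
  have h3 := real_inner_le_norm
    (∑ μ ∈ s, (eigenspace (Q : H →ₗ[ℝ] H) (μ : ℝ)).starProjection x) x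
  rw [← h2, ← h1] at h3
  rw [← h1]
  set N := ‖∑ μ ∈ s, (eigenspace (Q : H →ₗ[ℝ] H) (μ : ℝ)).starProjection x‖
  have hN : 0 ≤ N := norm_nonneg _
  have hx : 0 ≤ ‖x‖ := norm_nonneg _
  have : N ≤ ‖x‖ := by
    by_contra hc
    push Not at hc
    nlinarith
  gcongr

lemma norm_sum_smul_proj_le (hQ : (Q : H →ₗ[ℝ] H).IsSymmetric) (φ : ℝ → ℝ) {C : ℝ} (hC : 0 ≤ C)
    (hφ : ∀ μ : Eigenvalues (Q : H →ₗ[ℝ] H), |φ μ| ≤ C) (x : H)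
    (s : Finset (Eigenvalues (Q : H →ₗ[ℝ] H))) :
    ‖∑ μ ∈ s, φ (μ : ℝ) • (eigenspace (Q : H →ₗ[ℝ] H) (μ : ℝ)).starProjection x‖ ≤ C * ‖x‖ := by
  have hV := hQ.orthogonalFamily_eigenspaces'
  have h1 := hV.norm_sum
    (fun μ => φ (μ : ℝ) • (eigenspace (Q : H →ₗ[ℝ] H) (μ : ℝ)).orthogonalProjectionOnto x) s
  have h1' : ‖∑ μ ∈ s, φ (μ : ℝ) • (eigenspace (Q : H →ₗ[ℝ] H) (μ : ℝ)).starProjection x‖ ^ 2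
      = ∑ μ ∈ s, (|φ μ| * ‖(eigenspace (Q : H →ₗ[ℝ] H) (μ : ℝ)).starProjection x‖) ^ 2 := by
    simp only [norm_smul, Real.norm_eq_abs] at h1
    exact h1
  refine abs_le_of_sq_le_sq' ?_ (by positivity) |>.2
  rw [h1', mul_pow]
  calc _ ≤ ∑ μ ∈ s, C ^ 2 * ‖(eigenspace (Q : H →ₗ[ℝ] H) (μ : ℝ)).starProjection x‖ ^ 2 := by
        refine Finset.sum_le_sum fun μ _ => ?_
        rw [mul_pow]
        gcongr
        exact hφ μ
    _ ≤ _ := by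
        rw [← Finset.mul_sum]
        gcongr
        exact sum_norm_sq_proj_le hQ x s

lemma summable_spectralSum (hQ : (Q : H →ₗ[ℝ] H).IsSymmetric) (φ : ℝ → ℝ) {C : ℝ}
    (hφ : ∀ μ : Eigenvalues (Q : H →ₗ[ℝ] H), |φ μ| ≤ C) (x : H) :
    Summable fun μ : Eigenvalues (Q : H →ₗ[ℝ] H) =>
      φ (μ : ℝ) • (eigenspace (Q : H →ₗ[ℝ] H) (μ : ℝ)).starProjection x := by
  have hV := hQ.orthogonalFamily_eigenspaces'
  refine (hV.summable_iff_norm_sq_summable (fun μ =>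
    φ (μ : ℝ) • (eigenspace (Q : H →ₗ[ℝ] H) (μ : ℝ)).orthogonalProjectionOnto x)).2 ?_
  refine summable_of_sum_le (c := C ^ 2 * ‖x‖ ^ 2) (fun _ => by positivity) fun s => ?_
  calc _ ≤ ∑ μ ∈ s, C ^ 2 * ‖(eigenspace (Q : H →ₗ[ℝ] H) (μ : ℝ)).starProjection x‖ ^ 2 := by
        refine Finset.sum_le_sum fun μ _ => ?_
        rw [norm_smul, mul_pow, Real.norm_eq_abs]
        have := hφ μ
        gcongr
        rfl
    _ ≤ _ := by
        rw [← Finset.mul_sum]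
        gcongr
        exact sum_norm_sq_proj_le hQ x s

lemma norm_spectralSum_le (hQ : (Q : H →ₗ[ℝ] H).IsSymmetric) (φ : ℝ → ℝ) {C : ℝ} (hC : 0 ≤ C)
    (hφ : ∀ μ : Eigenvalues (Q : H →ₗ[ℝ] H), |φ μ| ≤ C) (x : H) :
    ‖spectralSum Q φ x‖ ≤ C * ‖x‖ :=
  le_of_tendsto ((summable_spectralSum hQ φ hφ x).hasSum.norm)
    (Filter.Eventually.of_forall fun s => norm_sum_smul_proj_le hQ φ hC hφ x s)

/-- For `φ` bounded on the eigenvalues of `Q`, `φ(Q)` as a bounded operator. -/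
noncomputable def spectralCLM (hQ : (Q : H →ₗ[ℝ] H).IsSymmetric) (φ : ℝ → ℝ) (C : ℝ) (hC : 0 ≤ C)
    (hφ : ∀ μ : Eigenvalues (Q : H →ₗ[ℝ] H), |φ μ| ≤ C) : H →L[ℝ] H :=
  LinearMap.mkContinuous
    { toFun := spectralSum Q φ
      map_add' := fun x y => by
        simp only [spectralSum, map_add, smul_add]
        exact (summable_spectralSum hQ φ hφ x).tsum_add (summable_spectralSum hQ φ hφ y)
      map_smul' := fun c x => by
        simp only [spectralSum, map_smul, smul_comm _ c, RingHom.id_apply]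
        exact (summable_spectralSum hQ φ hφ x).tsum_const_smul c }
    C (norm_spectralSum_le hQ φ hC hφ)

lemma spectralSum_eigenvector (hQ : (Q : H →ₗ[ℝ] H).IsSymmetric) (φ : ℝ → ℝ) {μ : ℝ} {v : H}
    (hv : Q v = μ • v) : spectralSum Q φ v = φ μ • v := by
  by_cases hv0 : v = 0
  · subst hv0
    simp [spectralSum]
  have hmem : v ∈ eigenspace (Q : H →ₗ[ℝ] H) μ := mem_eigenspace_iff.2 hv
  have hev : HasEigenvalue (Q : H →ₗ[ℝ] H) μ := hasEigenvalue_of_hasEigenvector ⟨hmem, hv0⟩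
  unfold spectralSum
  let μ' : Eigenvalues (Q : H →ₗ[ℝ] H) := ⟨μ, hev⟩
  rw [tsum_eq_single μ']
  · change φ μ • (eigenspace (Q : H →ₗ[ℝ] H) μ).starProjection v = _
    rw [Submodule.starProjection_eq_self_iff.2 hmem]
  · intro ν hν
    have : (eigenspace (Q : H →ₗ[ℝ] H) (ν : ℝ)).starProjection v = 0 := by
      rw [Submodule.starProjection_apply_eq_zero_iff, Submodule.mem_orthogonal]
      intro u hu
      exact hQ.orthogonalFamily_eigenspaces' hν ⟨u, hu⟩ ⟨v, hmem⟩
    rw [this, smul_zero]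

lemma spectralSum_inner (hQ : (Q : H →ₗ[ℝ] H).IsSymmetric) (φ : ℝ → ℝ) {C : ℝ}
    (hφ : ∀ μ : Eigenvalues (Q : H →ₗ[ℝ] H), |φ μ| ≤ C) (x y : H) :
    ⟪spectralSum Q φ x, y⟫ = ⟪x, spectralSum Q φ y⟫ := by
  have h1 := (summable_spectralSum hQ φ hφ x).hasSum.mapL (innerSL ℝ y)
  have h2 := (summable_spectralSum hQ φ hφ y).hasSum.mapL (innerSL ℝ x)
  rw [real_inner_comm]
  refine h1.unique ?_
  convert! h2 using 2 with μ
  simp only [innerSL_apply_apply, inner_smul_right]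
  rw [← Submodule.inner_starProjection_left_eq_right, real_inner_comm]

lemma ext_eigen (hQ : (Q : H →ₗ[ℝ] H).IsSymmetric) (hc : IsCompactOperator Q)
    {x y : H} (h : ∀ (μ : ℝ) (v : H), Q v = μ • v → ⟪x, v⟫ = ⟪y, v⟫) : x = y := by
  have h0 := ContinuousLinearMap.orthogonalComplement_iSup_eigenspaces_eq_bot hc hQ
  have : x - y ∈ (⨆ μ, eigenspace (Q : Module.End ℝ H) μ)ᗮ := by
    rw [Submodule.mem_orthogonal']
    intro u hu
    induction hu using Submodule.iSup_induction' with
    | mem μ v hv =>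
      rw [inner_sub_left, h μ v (mem_eigenspace_iff.1 hv), sub_self]
    | zero => simp
    | add a b _ _ ha hb => rw [inner_add_right, ha, hb, add_zero]
  rw [h0, Submodule.mem_bot] at this
  exact sub_eq_zero.1 this

end spectral

section semigroup

variable {H : Type*} [NormedAddCommGroup H] [InnerProductSpace ℝ H]
variable {Q : H →L[ℝ] H}

lemma eigenvalue_pos (hQ : (Q : H →ₗ[ℝ] H).IsPositive) (hinj : Function.Injective Q)
    {μ : ℝ} {v : H} (hv : Q v = μ • v) (hv0 : v ≠ 0) : 0 < μ := by
  have h1 : 0 ≤ ⟪Q v, v⟫ := hQ.re_inner_nonneg_left v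
  rw [hv, inner_smul_left] at h1
  simp only [conj_trivial] at h1
  have h2 : 0 < ⟪v, v⟫ := real_inner_self_pos.2 hv0
  have h3 : 0 ≤ μ := nonneg_of_mul_nonneg_left h1 h2
  refine lt_of_le_of_ne h3 fun h => hv0 (hinj ?_)
  rw [hv, ← h, zero_smul, map_zero]

lemma eigenvalues_pos (hQ : (Q : H →ₗ[ℝ] H).IsPositive) (hinj : Function.Injective Q)
    (μ : Eigenvalues (Q : H →ₗ[ℝ] H)) : 0 < (μ : ℝ) := by
  obtain ⟨v, hv⟩ := HasEigenvalue.exists_hasEigenvector (f := (Q : H →ₗ[ℝ] H)) μ.2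
  exact eigenvalue_pos hQ hinj (mem_eigenspace_iff.1 hv.1) hv.2

lemma eigenvalues_le (μ : Eigenvalues (Q : H →ₗ[ℝ] H)) : |(μ : ℝ)| ≤ ‖Q‖ := by
  obtain ⟨v, hv⟩ := HasEigenvalue.exists_hasEigenvector (f := (Q : H →ₗ[ℝ] H)) μ.2
  have h1 := Q.le_opNorm v
  rw [show Q v = (μ : ℝ) • v from mem_eigenspace_iff.1 hv.1, norm_smul, Real.norm_eq_abs] at h1
  exact le_of_mul_le_mul_right h1 (norm_pos_iff.2 hv.2)

lemma abs_exp_le (hQ : (Q : H →ₗ[ℝ] H).IsPositive) (hinj : Function.Injective Q)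
    {t : ℝ} (ht : 0 ≤ t) (μ : Eigenvalues (Q : H →ₗ[ℝ] H)) :
    |Real.exp (-t / (2 * (μ : ℝ)))| ≤ 1 := by
  rw [abs_of_pos (Real.exp_pos _), Real.exp_le_one_iff]
  have := eigenvalues_pos hQ hinj μ
  rw [neg_div]
  have : 0 ≤ t / (2 * (μ : ℝ)) := by positivity
  linarith

lemma abs_one_sub_exp_le (hQ : (Q : H →ₗ[ℝ] H).IsPositive) (hinj : Function.Injective Q)
    {t : ℝ} (ht : 0 ≤ t) (μ : Eigenvalues (Q : H →ₗ[ℝ] H)) :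
    0 ≤ 1 - Real.exp (-t / (μ : ℝ)) ∧ 1 - Real.exp (-t / (μ : ℝ)) ≤ 1 := by
  have h0 := eigenvalues_pos hQ hinj μ
  have h1 : Real.exp (-t / (μ : ℝ)) ≤ 1 := by
    rw [Real.exp_le_one_iff, neg_div]
    have : 0 ≤ t / (μ : ℝ) := by positivity
    linarith
  have h2 := Real.exp_pos (-t / (μ : ℝ))
  constructor <;> linarith

variable [CompleteSpace H]

lemma expA_sub_le (hQ : (Q : H →ₗ[ℝ] H).IsPositive) (hinj : Function.Injective Q)
    {t : ℝ} (ht : 0 ≤ t) (x y : H) : ‖expA Q t x - expA Q t y‖ ≤ ‖x - y‖ := by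
  let T := spectralCLM hQ.isSymmetric (fun μ => Real.exp (-t / (2 * μ))) 1 zero_le_one
        (abs_exp_le hQ hinj ht)
  change ‖T x - T y‖ ≤ _
  rw [← map_sub]
  refine (norm_spectralSum_le hQ.isSymmetric
    (fun μ => Real.exp (-t / (2 * μ))) zero_le_one (abs_exp_le hQ hinj ht) (x - y)).trans ?_
  rw [one_mul]

lemma expA_eigenvector (hQ : (Q : H →ₗ[ℝ] H).IsPositive) (t : ℝ) {μ : ℝ} {v : H}
    (hv : Q v = μ • v) : expA Q t v = Real.exp (-t / (2 * μ)) • v :=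
  spectralSum_eigenvector hQ.isSymmetric _ hv

lemma continuousOn_expA (hQ : (Q : H →ₗ[ℝ] H).IsPositive) (hinj : Function.Injective Q)
    (hc : IsCompactOperator Q) (x : H) : ContinuousOn (fun s => expA Q s x) (Set.Ici 0) := by
  have h1 : spectralSum Q (fun _ => 1) x = x := by
    refine ext_eigen hQ.isSymmetric hc fun μ v hv => ?_
    rw [spectralSum_inner hQ.isSymmetric _ (C := 1) (by simp),
      spectralSum_eigenvector hQ.isSymmetric _ hv, one_smul]
  have h2 := (summable_spectralSum hQ.isSymmetric (fun _ => 1) (C := 1) (by simp) x).hasSum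
  rw [show ∑' _, _ = _ from h1] at h2
  refine continuousOn_of_uniform_approx_of_continuousOn fun u hu => ?_
  obtain ⟨ε, hε, hεu⟩ := Metric.mem_uniformity_dist.1 hu
  obtain ⟨F, hF⟩ := ((Metric.tendsto_nhds.1 h2) ε hε).exists
  refine ⟨fun s => expA Q s (∑ μ ∈ F, (1 : ℝ) •
    (eigenspace (Q : H →ₗ[ℝ] H) (μ : ℝ)).starProjection x), ?_, fun s hs => hεu ?_⟩
  · have : Set.EqOn (fun s => expA Q s (∑ μ ∈ F, (1 : ℝ) •
      (eigenspace (Q : H →ₗ[ℝ] H) (μ : ℝ)).starProjection x))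
      (fun s => ∑ μ ∈ F, Real.exp (-s / (2 * (μ : ℝ))) •
      (eigenspace (Q : H →ₗ[ℝ] H) (μ : ℝ)).starProjection x) (Set.Ici 0) := by
      intro s hs
      let T := spectralCLM hQ.isSymmetric (fun μ => Real.exp (-s / (2 * μ))) 1 zero_le_one
        (abs_exp_le hQ hinj hs)
      change T _ = _
      rw [map_sum]
      refine Finset.sum_congr rfl fun μ _ => ?_
      rw [one_smul]
      exact expA_eigenvector hQ s (mem_eigenspace_iff.1 (Submodule.starProjection_apply_mem _ _))
    refine ContinuousOn.congr (Continuous.continuousOn ?_) this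
    fun_prop
  · rw [dist_comm] at hF
    rw [dist_eq_norm] at hF ⊢
    exact (expA_sub_le hQ hinj hs _ _).trans_lt hF

lemma expA_inner (hQ : (Q : H →ₗ[ℝ] H).IsPositive) (hinj : Function.Injective Q)
    {t : ℝ} (ht : 0 ≤ t) (x y : H) : ⟪expA Q t x, y⟫ = ⟪x, expA Q t y⟫ :=
  spectralSum_inner hQ.isSymmetric _ (abs_exp_le hQ hinj ht) x y

lemma integral_exp_div {μ : ℝ} (hμ : 0 < μ) (t : ℝ) :
    ∫ s in (0 : ℝ)..t, Real.exp (-(2 * s) / (2 * μ)) = μ * (1 - Real.exp (-t / μ)) := by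
  have h : ∀ s ∈ Set.uIcc 0 t, HasDerivAt (fun s => -μ * Real.exp (-s / μ))
      (Real.exp (-(2 * s) / (2 * μ))) s := by
    intro s _
    have := (((hasDerivAt_id s).neg.div_const μ).exp).const_mul (-μ)
    convert! this using 1
    simp only [id, Pi.neg_apply]
    rw [show -(2 * s) / (2 * μ) = -s / μ by field_simp]
    field_simp
  rw [intervalIntegral.integral_eq_sub_of_hasDerivAt h (Continuous.intervalIntegrable
    (by fun_prop) _ _)]
  simp
  ring

/-- `Q_t = Q (1 - e^{2tA})`. -/
lemma covT_eq (hQ : (Q : H →ₗ[ℝ] H).IsPositive) (hinj : Function.Injective Q)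
    (hc : IsCompactOperator Q) {t : ℝ} (ht : 0 ≤ t) (x : H) :
    covT Q t x = Q (x - expA Q (2 * t) x) := by
  have hint : IntervalIntegrable (fun s => expA Q (2 * s) x) volume 0 t := by
    refine ContinuousOn.intervalIntegrable ?_
    rw [Set.uIcc_of_le ht]
    exact (continuousOn_expA hQ hinj hc x).comp (by fun_prop)
      (fun s hs => Set.mem_Ici.2 (by linarith [hs.1]))
  refine ext_eigen hQ.isSymmetric hc fun μ v hv => ?_
  by_cases hv0 : v = 0
  · simp [hv0]
  have hμ := eigenvalue_pos hQ hinj hv hv0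
  rw [covT, real_inner_comm, ← innerSL_apply_apply ℝ v,
    ← ContinuousLinearMap.intervalIntegral_comp_comm _ hint]
  have : ∀ s ∈ Set.uIcc 0 t, innerSL ℝ v (expA Q (2 * s) x) =
      Real.exp (-(2 * s) / (2 * μ)) * ⟪x, v⟫ := by
    intro s hs
    rw [Set.uIcc_of_le ht] at hs
    rw [innerSL_apply_apply, real_inner_comm, expA_inner hQ hinj (by linarith [hs.1]),
      expA_eigenvector hQ _ hv, inner_smul_right]
  rw [intervalIntegral.integral_congr this, intervalIntegral.integral_mul_const,
    integral_exp_div hμ]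
  have h2 : ⟪Q (x - expA Q (2 * t) x), v⟫ = ⟪x - expA Q (2 * t) x, Q v⟫ := hQ.isSymmetric _ _
  rw [h2, hv, inner_smul_right, inner_sub_left, expA_inner hQ hinj (by linarith),
    expA_eigenvector hQ _ hv, inner_smul_right, show -(2 * t) / (2 * μ) = -t / μ by field_simp]
  ring

end semigroup

section gaussian
variable {H : Type*} [NormedAddCommGroup H] [InnerProductSpace ℝ H] [CompleteSpace H]
  [SecondCountableTopology H] [MeasurableSpace H] [BorelSpace H]

lemma isCompactOperator_covarianceOperator (m : Measure H) [IsProbabilityMeasure m]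
    (hm : MemLp id 2 m) : IsCompactOperator (covarianceOperator m) := by
  have hint : Integrable (fun z : H => InnerProductSpace.rankOne ℝ z z) m := by
    refine (hm.integrable_norm_pow (by norm_num)).mono ?_ ?_
    · exact Continuous.aestronglyMeasurable
        ((InnerProductSpace.rankOne ℝ).continuous.clm_apply continuous_id)
    · filter_upwards with z
      simp [pow_two]
  have h1 : covarianceOperator m = ∫ z, InnerProductSpace.rankOne ℝ z z ∂m := by
    ext x
    rw [covarianceOperator_apply hm, ContinuousLinearMap.integral_apply hint]
    simp [real_inner_comm]
  rw [h1]
  have hcl : IsClosed ({T | IsCompactOperator T} : Set (H →L[ℝ] H)) :=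
    isClosed_setOfPred_isCompactOperator
  have hcv : Convex ℝ ({T | IsCompactOperator T} : Set (H →L[ℝ] H)) := by
    exact (compactOperator (RingHom.id ℝ) H H).convex
  refine hcv.integral_mem hcl ?_ hint
  filter_upwards with z
  have h2 : IsCompactOperator (ContinuousLinearMap.toSpanSingleton ℝ z) :=
    isCompactOperator_of_locallyCompactSpace_rng _
  exact h2.comp_clm (innerSL ℝ z)

/-- The Gaussian measure `N_{0,Q_t}` exists, so that `gaussianMeasure 0 Q_t` is this measure. -/
theorem isGaussianWith_gaussianMeasure (m : Measure H) [IsGaussian m] (hmean : ∫ x, x ∂m = 0)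
    (hinj : Function.Injective (covarianceOperator m)) {t : ℝ} (ht : 0 ≤ t) :
    IsGaussianWith (0 : H) (covT (covarianceOperator m) t)
      (gaussianMeasure (0 : H) (covT (covarianceOperator m) t)) := by
  have hm : MemLp id 2 m := IsGaussian.memLp_two_id
  have hc := isCompactOperator_covarianceOperator m hm
  have hQ : (covarianceOperator m).toLinearMap.IsPositive := isPositive_covarianceOperator
  suffices h : ∃ μ : Measure H, IsGaussianWith (0 : H) (covT (covarianceOperator m) t) μ by
    rw [gaussianMeasure, dif_pos h]
    exact h.choose_spec
  set Q := covarianceOperator m with hQdef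
  have hb : ∀ μ : Eigenvalues (Q : H →ₗ[ℝ] H),
      |(fun μ : ℝ => √(1 - Real.exp (-t / μ))) (μ : ℝ)| ≤ 1 := by
    intro μ
    have := abs_one_sub_exp_le hQ hinj ht μ
    rw [abs_of_nonneg (Real.sqrt_nonneg _), Real.sqrt_le_iff]
    exact ⟨zero_le_one, by simpa using this.2⟩
  let S := spectralCLM hQ.isSymmetric (fun μ : ℝ => √(1 - Real.exp (-t / μ))) 1 zero_le_one hb
  have hSinner : ∀ x y, ⟪S x, y⟫ = ⟪x, S y⟫ := spectralSum_inner hQ.isSymmetric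
    (fun μ : ℝ => √(1 - Real.exp (-t / μ))) hb
  have hSadj : S.adjoint = S :=
    ((ContinuousLinearMap.eq_adjoint_iff S S).2 hSinner).symm
  have hS : ∀ (μ : ℝ) (v : H), Q v = μ • v → S v = √(1 - Real.exp (-t / μ)) • v :=
    fun μ v hv => spectralSum_eigenvector hQ.isSymmetric
      (fun μ : ℝ => √(1 - Real.exp (-t / μ))) hv
  refine ⟨m.map S, inferInstance, ?_, fun x y => ?_⟩
  · rw [integral_map (by fun_prop) (by fun_prop)]
    have := S.integral_comp_comm (hm.integrable (by norm_num))
    simp only [id] at this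
    rw [this, hmean, map_zero]
  · rw [covarianceBilin_map hm, hSadj, covarianceBilin_apply hm]
    simp only [id, hmean, sub_zero]
    rw [← covarianceOperator_inner hm, ← hSinner]
    have : S (Q (S x)) = covT Q t x := by
      rw [covT_eq hQ hinj hc ht]
      refine ext_eigen hQ.isSymmetric hc fun μ v hv => ?_
      by_cases hv0 : v = 0
      · simp [hv0]
      have hμ := eigenvalue_pos hQ hinj hv hv0
      have hsq : 0 ≤ 1 - Real.exp (-t / μ) := by
        have : 0 ≤ t / μ := by positivity
        rw [sub_nonneg, Real.exp_le_one_iff, neg_div]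
        linarith
      have hQinner : ∀ x y, ⟪Q x, y⟫ = ⟪x, Q y⟫ := hQ.isSymmetric
      rw [hSinner, hS μ v hv, inner_smul_right, hQinner, hv, inner_smul_right, hSinner, hS μ v hv,
        inner_smul_right, hQinner, hv, inner_smul_right, inner_sub_left,
        expA_inner hQ hinj (by linarith), expA_eigenvector hQ _ hv, inner_smul_right,
        show -(2 * t) / (2 * μ) = -t / μ by field_simp]
      linear_combination (μ * ⟪x, v⟫) * Real.mul_self_sqrt hsq
    rw [← this]

end gaussian

end OUSemigroup

/-!
The inequality is Hölder's inequality combined with the Cameron-Martin formula.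

Write `ν = N_{Q_t}`, `d = x₁ - x₀`, `k = e^{tA} d` and `F(y) = g(e^{tA}((1 - s) x₀ + s x₁) + y)`.
Then `P_t g` at the intermediate point, at `x₀` and at `x₁` is the `ν`-integral of `F`, of
`F(· - s k)` and of `F(· + (1 - s) k)`. The shift `k` lies in the range of `Q_t` itself: on the
eigenspace of an eigenvalue `μ` of `Q` the operator `Q_t⁻¹ e^{tA}` is multiplication by
`e^{-t/(2μ)} / (μ (1 - e^{-t/μ})) = 1 / (2 μ sinh (t / (2μ)))`, which is at most `1 / t` because
`u ≤ sinh u`. Hence `k = Q_t w` with `|w| ≤ |d| / t` (`exists_covT_eq_expA`), and the density of a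
translate of `ν` by `c k` is the explicit continuous function
`exp (c ⟪w, y⟫ - c² ⟪k, w⟫ / 2)` (`map_add_const_eq_tilted`); no measurable linear functional
defined only almost everywhere is needed. The formula is verified on characteristic functions.

The densities `ρ₀`, `ρ₁` for `c = -s` and `c = 1 - s` satisfy
`ρ₀^{1-s} ρ₁^s = exp (-s (1 - s) ⟪k, w⟫ / 2)`, a constant, so that Hölder's inequality for
`(ρ₀ F)^{1-s} (ρ₁ F)^s` gives the claim with the factor `exp (s (1 - s) ⟪k, w⟫ / 2)`
(`lintegral_le_of_shift`). Finally `⟪k, w⟫ ≤ |e^{tA} d| |w| ≤ |d|² / t`.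
-/

namespace OUSemigroup

section cameronMartin

variable {H : Type*} [NormedAddCommGroup H] [InnerProductSpace ℝ H] [MeasurableSpace H]
  [BorelSpace H]

/-- Gram-Schmidt for the covariance form. If `⟪w, ·⟫` is almost surely constant, then it is
uncorrelated with every other functional by the Cauchy-Schwarz inequality. -/
lemma exists_covarianceBilin_sub_smul_eq_zero (ν : Measure H) (w z : H) :
    ∃ a : ℝ, covarianceBilin ν (z - a • w) w = 0 := by
  refine ⟨covarianceBilin ν z w / covarianceBilin ν w w, ?_⟩
  simp only [map_sub, map_smul, sub_apply, smul_apply, smul_eq_mul]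
  rcases eq_or_ne (covarianceBilin ν w w) 0 with h | h
  -- Here the coefficient is the junk value `0` of a division by zero, which is a valid choice.
  · have hcs := LinearMap.BilinForm.apply_mul_apply_le_of_forall_zero_le
      (covarianceBilin ν).toBilinForm covarianceBilin_self_nonneg z w
    simp only [ContinuousLinearMap.toBilinForm_apply, h, mul_zero,
      covarianceBilin_comm w z] at hcs
    rw [h, mul_zero, sub_zero]
    nlinarith
  · field_simp
    ring

variable [CompleteSpace H] [SecondCountableTopology H]

lemma map_inner_eq_gaussianReal (ν : Measure H) [IsGaussian ν] (w : H) :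
    ν.map (fun y => ⟪w, y⟫) =
      gaussianReal ⟪w, ∫ y, y ∂ν⟫ (covarianceBilin ν w w).toNNReal := by
  have h : HasGaussianLaw (fun y => ⟪w, y⟫) ν :=
    (IsGaussian.hasGaussianLaw_id (μ := ν)).map (innerSL ℝ w)
  rw [h.map_eq_gaussianReal, covarianceBilin_self IsGaussian.memLp_two_id,
    ← integral_inner (f := fun y => y) IsGaussian.integrable_id]

lemma integrable_exp_inner (ν : Measure H) [IsGaussian ν] (w : H) :
    Integrable (fun y => Real.exp ⟪w, y⟫) ν := by
  have h := integrable_exp_mul_gaussianReal (μ := ⟪w, ∫ y, y ∂ν⟫)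
    (v := (covarianceBilin ν w w).toNNReal) 1
  rw [← map_inner_eq_gaussianReal, integrable_map_measure (by fun_prop) (by fun_prop)] at h
  simpa [Function.comp_def] using h

lemma integral_exp_inner (ν : Measure H) [IsGaussian ν] (w : H) :
    ∫ y, Real.exp ⟪w, y⟫ ∂ν = Real.exp (⟪w, ∫ y, y ∂ν⟫ + covarianceBilin ν w w / 2) := by
  have h := mgf_gaussianReal (map_inner_eq_gaussianReal ν w) 1
  rw [Real.coe_toNNReal _ (covarianceBilin_self_nonneg w)] at h
  simpa [mgf] using h

/-- The Laplace-Fourier transform of a Gaussian measure. The functional `⟪z, ·⟫` is split into a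
multiple of `⟪w, ·⟫` and a functional independent of `⟪w, ·⟫`. -/
lemma integral_cexp_inner (ν : Measure H) [IsGaussian ν] (w z : H) :
    ∫ y, Complex.exp (⟪z, y⟫ * Complex.I) * Real.exp ⟪w, y⟫ ∂ν =
      Complex.exp (⟪z, ∫ y, y ∂ν⟫ * Complex.I + ⟪w, ∫ y, y ∂ν⟫
        + (covarianceBilin ν w w - covarianceBilin ν z z) / 2
        + covarianceBilin ν w z * Complex.I) := by
  obtain ⟨a, ha⟩ := exists_covarianceBilin_sub_smul_eq_zero ν w z
  obtain ⟨z', rfl⟩ : ∃ z', z = z' + a • w := ⟨z - a • w, by simp⟩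
  rw [add_sub_cancel_right] at ha
  have hind : IndepFun (fun y => ⟪z', y⟫) (fun y => ⟪w, y⟫) ν := by
    refine HasGaussianLaw.indepFun_of_covariance_eq_zero ?_ ?_
    · exact (IsGaussian.hasGaussianLaw_id (μ := ν)).map ((innerSL ℝ z').prod (innerSL ℝ w))
    · rw [← covarianceBilin_apply_eq_cov IsGaussian.memLp_two_id, ha]
  have h1 := hind.integral_fun_comp_mul_comp (𝕜 := ℂ)
    (f := fun r : ℝ => Complex.exp (r * Complex.I))
    (g := fun r : ℝ => Complex.exp ((1 + a * Complex.I) * r)) (by fun_prop) (by fun_prop)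
    (by fun_prop) (by fun_prop)
  have h2 := IsGaussian.charFun_eq' (μ := ν) z'
  simp only [charFun_apply, real_inner_comm z'] at h2
  have h3 : ∫ y, Complex.exp ((1 + a * Complex.I) * ⟪w, y⟫) ∂ν = _ :=
    complexMGF_gaussianReal (map_inner_eq_gaussianReal ν w) (1 + a * Complex.I)
  rw [h2, h3, ← Complex.exp_add, Real.coe_toNNReal _ (covarianceBilin_self_nonneg w)] at h1
  convert! h1 using 2
  · ext y
    rw [Complex.ofReal_exp, ← Complex.exp_add, ← Complex.exp_add, inner_add_left, inner_smul_left]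
    congr 1
    push_cast
    simp only [conj_trivial]
    ring
  · simp only [map_add, map_smul, add_apply, smul_apply, smul_eq_mul, covarianceBilin_comm w z', ha, inner_add_left, inner_smul_left, id, conj_trivial]
    push_cast
    ring_nf
    rw [Complex.I_sq]
    ring

/-- The **Cameron-Martin formula** for shifts in the range of the covariance operator: if `k` is
the image of `w` under the covariance operator of `ν`, then the translate of `ν` by `k` has a
density proportional to `exp ⟪w, ·⟫`. -/
theorem map_add_const_eq_tilted (ν : Measure H) [IsGaussian ν] {w k : H}
    (hk : ∀ y, covarianceBilin ν w y = ⟪k, y⟫) :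
    ν.map (· + k) = ν.tilted (fun y => ⟪w, y⟫) := by
  have := isProbabilityMeasure_tilted (integrable_exp_inner ν w)
  refine Measure.ext_of_charFun (funext fun z => ?_)
  rw [charFun_map_add_const, IsGaussian.charFun_eq', charFun_apply, integral_tilted]
  simp_rw [integral_exp_inner, real_inner_comm z, Complex.real_smul, Complex.ofReal_div,
    div_mul_eq_mul_div, mul_comm (Complex.ofReal (Real.exp _)) (Complex.exp _)]
  rw [integral_div, integral_cexp_inner, Complex.ofReal_exp, ← Complex.exp_add, ← Complex.exp_sub,
    hk z, real_inner_comm k z]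
  congr 1
  push_cast
  simp only [id]
  ring

lemma lintegral_add_const_eq (ν : Measure H) [IsGaussian ν] {w k : H}
    (hk : ∀ y, covarianceBilin ν w y = ⟪k, y⟫) (c : ℝ) {F : H → ℝ≥0∞} (hF : Measurable F) :
    ∫⁻ y, F (y + c • k) ∂ν =
      ∫⁻ y, ENNReal.ofReal (Real.exp (c * ⟪w, y - ∫ z, z ∂ν⟫ - c ^ 2 * ⟪k, w⟫ / 2)) * F y ∂ν := by
  have hck : ∀ y, covarianceBilin ν (c • w) y = ⟪c • k, y⟫ := fun y => by
    simp [hk, inner_smul_left]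
  rw [← lintegral_map hF (measurable_add_const _), map_add_const_eq_tilted ν hck,
    lintegral_tilted]
  refine lintegral_congr fun y => ?_
  rw [integral_exp_inner, ← Real.exp_sub, hck]
  congr 3
  simp only [inner_smul_left, inner_smul_right, inner_sub_right, conj_trivial]
  ring

/-- Hölder's inequality against the two Cameron-Martin densities: their geometric mean with
weights `1 - s` and `s` is the constant `exp (-s (1 - s) ⟪k, w⟫ / 2)`. -/
theorem lintegral_le_of_shift (ν : Measure H) [IsGaussian ν] {w k : H}
    (hk : ∀ y, covarianceBilin ν w y = ⟪k, y⟫) {F : H → ℝ≥0∞} (hF : Measurable F)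
    {s : ℝ} (hs0 : 0 ≤ s) (hs1 : s ≤ 1) :
    ∫⁻ y, F y ∂ν ≤ ENNReal.ofReal (Real.exp (s * (1 - s) * ⟪k, w⟫ / 2)) *
      (∫⁻ y, F (y + (-s) • k) ∂ν) ^ (1 - s) * (∫⁻ y, F (y + (1 - s) • k) ∂ν) ^ s := by
  have hs1' : 0 ≤ 1 - s := sub_nonneg.2 hs1
  rw [lintegral_add_const_eq ν hk _ hF, lintegral_add_const_eq ν hk _ hF]
  set ρ : ℝ → H → ℝ := fun c y => Real.exp (c * ⟪w, y - ∫ z, z ∂ν⟫ - c ^ 2 * ⟪k, w⟫ / 2)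
  have hρ : ∀ c, Measurable fun y => ENNReal.ofReal (ρ c y) * F y := fun c => by
    simp only [ρ]
    fun_prop
  have hpt : ∀ y, F y = ENNReal.ofReal (Real.exp (s * (1 - s) * ⟪k, w⟫ / 2)) *
      ((ENNReal.ofReal (ρ (-s) y) * F y) ^ (1 - s) *
        (ENNReal.ofReal (ρ (1 - s) y) * F y) ^ s) := by
    intro y
    have hF' : F y ^ (1 - s) * F y ^ s = F y := by
      rw [← ENNReal.rpow_add_of_nonneg _ _ hs1' hs0, sub_add_cancel, ENNReal.rpow_one]
    rw [ENNReal.mul_rpow_of_nonneg _ _ hs1', ENNReal.mul_rpow_of_nonneg _ _ hs0,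
      mul_mul_mul_comm, hF', ENNReal.ofReal_rpow_of_pos (Real.exp_pos _),
      ENNReal.ofReal_rpow_of_pos (Real.exp_pos _), ← Real.exp_mul, ← Real.exp_mul, ← mul_assoc,
      ← ENNReal.ofReal_mul (Real.exp_nonneg _), ← ENNReal.ofReal_mul (Real.exp_nonneg _),
      ← Real.exp_add, ← Real.exp_add]
    ring_nf
    simp
  calc ∫⁻ y, F y ∂ν
      = ENNReal.ofReal (Real.exp (s * (1 - s) * ⟪k, w⟫ / 2)) *
        ∫⁻ y, (ENNReal.ofReal (ρ (-s) y) * F y) ^ (1 - s) *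
          (ENNReal.ofReal (ρ (1 - s) y) * F y) ^ s ∂ν := by
        rw [← lintegral_const_mul _ (by fun_prop)]
        exact lintegral_congr hpt
    _ ≤ _ := by
        rw [mul_assoc (ENNReal.ofReal _)]
        exact mul_le_mul_right (ENNReal.lintegral_mul_norm_pow_le (hρ _).aemeasurable
          (hρ _).aemeasurable hs1' hs0 (sub_add_cancel _ _)) _

end cameronMartin

section shift

variable {H : Type*} [NormedAddCommGroup H] [InnerProductSpace ℝ H] [CompleteSpace H]
variable {Q : H →L[ℝ] H}

/-- The scalar inequality `u ≤ sinh u` at `u = t / (2 μ)`, in the form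
`e^{-t/(2μ)} / (μ (1 - e^{-t/μ})) ≤ 1 / t`. -/
lemma inv_two_mul_sinh_le {t μ : ℝ} (ht : 0 < t) (hμ : 0 < μ) :
    |(2 * μ * Real.sinh (t / (2 * μ)))⁻¹| ≤ t⁻¹ := by
  have hu : 0 ≤ t / (2 * μ) := by positivity
  have h := Real.self_le_sinh_iff.2 hu
  rw [div_le_iff₀ (by positivity)] at h
  have h' : t ≤ 2 * μ * Real.sinh (t / (2 * μ)) := by linarith
  rw [abs_of_pos (inv_pos.2 (ht.trans_le h'))]
  exact inv_anti₀ ht h'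

/-- The range of `e^{tA}` is contained in the range of `Q_t`, and `|Q_t⁻¹ e^{tA} d| ≤ |d| / t`. -/
theorem exists_covT_eq_expA (hQ : (Q : H →ₗ[ℝ] H).IsPositive) (hinj : Function.Injective Q)
    (hc : IsCompactOperator Q) {t : ℝ} (ht : 0 < t) (d : H) :
    ∃ w : H, covT Q t w = expA Q t d ∧ ‖w‖ ≤ t⁻¹ * ‖d‖ := by
  have hb : ∀ μ : Eigenvalues (Q : H →ₗ[ℝ] H),
      |(fun μ : ℝ => (2 * μ * Real.sinh (t / (2 * μ)))⁻¹) (μ : ℝ)| ≤ t⁻¹ :=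
    fun μ => inv_two_mul_sinh_le ht (eigenvalues_pos hQ hinj μ)
  refine ⟨spectralSum Q (fun μ : ℝ => (2 * μ * Real.sinh (t / (2 * μ)))⁻¹) d, ?_,
    norm_spectralSum_le hQ.isSymmetric (fun μ : ℝ => (2 * μ * Real.sinh (t / (2 * μ)))⁻¹)
      (inv_nonneg.2 ht.le) hb d⟩
  rw [covT_eq hQ hinj hc ht.le]
  refine ext_eigen hQ.isSymmetric hc fun μ v hv => ?_
  by_cases hv0 : v = 0
  · simp [hv0]
  have hμ := eigenvalue_pos hQ hinj hv hv0
  have hQinner : ∀ x y, ⟪Q x, y⟫ = ⟪x, Q y⟫ := hQ.isSymmetric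
  rw [hQinner, hv, inner_smul_right, inner_sub_left, expA_inner hQ hinj (by linarith),
    expA_eigenvector hQ _ hv, inner_smul_right,
    spectralSum_inner hQ.isSymmetric (fun μ : ℝ => (2 * μ * Real.sinh (t / (2 * μ)))⁻¹) hb,
    spectralSum_eigenvector hQ.isSymmetric _ hv, inner_smul_right, expA_inner hQ hinj ht.le,
    expA_eigenvector hQ _ hv, inner_smul_right]
  have hsinh : 0 < Real.sinh (t / (2 * μ)) := Real.sinh_pos_iff.2 (by positivity)
  have hexp : 1 - Real.exp (-(2 * t) / (2 * μ)) =
      2 * Real.exp (-t / (2 * μ)) * Real.sinh (t / (2 * μ)) := by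
    rw [Real.sinh_eq, neg_div, neg_div, mul_div_assoc 2 t, two_mul (t / (2 * μ)), neg_add,
      Real.exp_add, Real.exp_neg]
    field_simp
  rw [← one_sub_mul, hexp]
  field_simp

end shift

end OUSemigroup

theorem mainTheorem7 {H : Type*} [NormedAddCommGroup H] [InnerProductSpace ℝ H] [CompleteSpace H]
    [SecondCountableTopology H] [MeasurableSpace H] [BorelSpace H]
    (m : Measure H) [IsGaussian m] (hmean : ∫ x, x ∂m = 0)
    (hnondeg : Function.Injective (covarianceOperator m))
    (g : H → ℝ) (hg : Measurable g) (hg0 : ∀ x, 0 ≤ g x) (t : ℝ) (ht : 0 < t) :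
    OUSemigroup.IsKConvex (-1 / t) (fun x =>
      ENNReal.log (OUSemigroup.semigroupP m t (fun y => ENNReal.ofReal (g y)) x)) ∧
    ∀ x₀ x₁ : H, ∀ s ∈ Set.Icc (0 : ℝ) 1,
      OUSemigroup.semigroupP m t (fun y => ENNReal.ofReal (g y)) ((1 - s) • x₀ + s • x₁) ≤
        ENNReal.ofReal (Real.exp (s * (1 - s) * ‖x₁ - x₀‖ ^ 2 / (2 * t))) *
          OUSemigroup.semigroupP m t (fun y => ENNReal.ofReal (g y)) x₀ ^ (1 - s) *
          OUSemigroup.semigroupP m t (fun y => ENNReal.ofReal (g y)) x₁ ^ s := by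
  have key : ∀ x₀ x₁ : H, ∀ s ∈ Set.Icc (0 : ℝ) 1,
      OUSemigroup.semigroupP m t (fun y => ENNReal.ofReal (g y)) ((1 - s) • x₀ + s • x₁) ≤
        ENNReal.ofReal (Real.exp (s * (1 - s) * ‖x₁ - x₀‖ ^ 2 / (2 * t))) *
          OUSemigroup.semigroupP m t (fun y => ENNReal.ofReal (g y)) x₀ ^ (1 - s) *
          OUSemigroup.semigroupP m t (fun y => ENNReal.ofReal (g y)) x₁ ^ s := by
    intro x₀ x₁ s hs
    have hQ : (covarianceOperator m).toLinearMap.IsPositive := isPositive_covarianceOperator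
    have hc := OUSemigroup.isCompactOperator_covarianceOperator m IsGaussian.memLp_two_id
    -- The measure in `semigroupP` is the Gaussian measure `N_{Q_t}`, not the junk value `0`.
    have hν := OUSemigroup.isGaussianWith_gaussianMeasure m hmean hnondeg ht.le
    have := hν.gaussian
    obtain ⟨w, hw, hwle⟩ := OUSemigroup.exists_covT_eq_expA hQ hnondeg hc ht (x₁ - x₀)
    let T := OUSemigroup.spectralCLM hQ.isSymmetric (fun μ => Real.exp (-t / (2 * μ))) 1
      zero_le_one (OUSemigroup.abs_exp_le hQ hnondeg ht.le)
    have hT : ∀ x, OUSemigroup.expA (covarianceOperator m) t x = T x := fun x => rfl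
    have hle : ⟪T (x₁ - x₀), w⟫ ≤ ‖x₁ - x₀‖ ^ 2 / t := by
      have h1 := OUSemigroup.expA_sub_le hQ hnondeg ht.le (x₁ - x₀) 0
      rw [hT, hT, map_zero, sub_zero, sub_zero] at h1
      calc ⟪T (x₁ - x₀), w⟫ ≤ ‖T (x₁ - x₀)‖ * ‖w‖ := real_inner_le_norm _ _
        _ ≤ ‖x₁ - x₀‖ * (t⁻¹ * ‖x₁ - x₀‖) := by gcongr
        _ = ‖x₁ - x₀‖ ^ 2 / t := by ring
    -- The base point is `(1 - s) x₀ + s x₁`, from which `x₀` and `x₁` are the shifts by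
    -- `-s (x₁ - x₀)` and `(1 - s) (x₁ - x₀)`.
    have h := OUSemigroup.lintegral_le_of_shift _ (w := w) (k := T (x₁ - x₀))
      (fun y => by rw [hν.cov, hw, hT])
      (F := fun y => ENNReal.ofReal (g (T ((1 - s) • x₀ + s • x₁) + y))) (by fun_prop) hs.1 hs.2
    have e₀ : ∀ y, T ((1 - s) • x₀ + s • x₁) + (y + (-s) • T (x₁ - x₀)) = T x₀ + y := fun y => by
      simp only [map_add, map_sub, map_smul]
      module
    have e₁ : ∀ y, T ((1 - s) • x₀ + s • x₁) + (y + (1 - s) • T (x₁ - x₀)) = T x₁ + y :=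
      fun y => by
        simp only [map_add, map_sub, map_smul]
        module
    simp only [e₀, e₁] at h
    refine h.trans ?_
    simp only [OUSemigroup.semigroupP, hT]
    gcongr ENNReal.ofReal (Real.exp ?_) * _ * _
    have hs' : 0 ≤ s * (1 - s) := mul_nonneg hs.1 (sub_nonneg.2 hs.2)
    calc s * (1 - s) * ⟪T (x₁ - x₀), w⟫ / 2 ≤ s * (1 - s) * (‖x₁ - x₀‖ ^ 2 / t) / 2 := by gcongr
      _ = _ := by ring
  refine ⟨fun x₀ x₁ s hs => ?_, key⟩
  -- `ENNReal.log` turns products and powers into sums and multiples also at `0` and `∞`, with the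
  -- same conventions (`0 * ∞ = 0`, `⊥ + ⊤ = ⊥`) on both sides.
  refine (ENNReal.log_le_log (key x₀ x₁ s hs)).trans_eq ?_
  rw [ENNReal.log_mul_add, ENNReal.log_mul_add, ENNReal.log_rpow, ENNReal.log_rpow,
    ENNReal.log_ofReal_of_pos (Real.exp_pos _), Real.log_exp, add_assoc, add_comm,
    sub_eq_add_neg _ (Real.toEReal _), ← EReal.coe_neg]
  congr 2
  ring
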